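/- For positive integers $r,m$ let $\sigma_r(m)=\sum_{d\mid m,\ d\ge 1}d^r$, put $\sigma_r(x)=0$ if $x$ is a rational number that is not a positive integer, and write $\sigma=\sigma_1$. For positive integers $a,b,r,s,n$ let $$W^{r,s}_{a,b}(n)=\sum_{\substack{l,m\ge 1\\ al+bm=n}}\sigma_r(l)\,\sigma_s(m).$$ Let $M_w(N)$ denote the finite-dimensional complex vector space of modular forms of weight $w$ on $\Gamma_0(N)$, let $\lambda_w(N)$ be its dimension, and let $B_k$ be the $k$-th Bernoulli number. Let $k\ge 4$ be an even integer and let $a,b$ be relatively prime positive integers. Let $f_1,\dots,f_\lambda$, where $\lambda=\lambda_{k+2}(ab)$, be any basis of $M_{k+2}(ab)$, and let $a_i(n)$ be the $n$-th Fourier coefficient of $f_i$, so that $f_i(z)=\sum_{n\ge 0}a_i(n)e^{2\pi i nz}$ (the $i$ in the exponent being the imaginary unit). Then there exist constants $\alpha_1,\dots,\alpha_\lambda\in\mathbb C$, independent of $n$, such that for every integer $n\ge 1$ $$W^{1,k-1}_{a,b}(n)=\frac{B_k}{2k}\,\sigma(n/a)+\Bigl(\frac1{24}-\frac{n}{2ka}\Bigr)\sigma_{k-1}(n/b)-\frac{B_k}{4ak^2}\sum_{i=1}^{\lambda}\alpha_i\,a_i(n).$$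 -/

import Mathlib

/-- The divisor function `σ_r(x) = ∑_{d ∣ x, d ≥ 1} d ^ r`, extended to rational arguments by
`σ_r(x) = 0` if `x` is not a positive integer. (For `x` an integer, `x.num = x`;
`Int.toNat` sends negative integers to `0`, and `ArithmeticFunction.sigma r 0 = 0`.) -/
def divSigma (r : ℕ) (x : ℚ) : ℕ :=
  if x.den = 1 then ArithmeticFunction.sigma r x.num.toNat else 0

/-- The convolution sum `W^{r,s}_{a,b}(n) = ∑_{l, m ≥ 1, a l + b m = n} σ_r(l) σ_s(m)`,
for positive integers `a` and `b`. The solutions `(l, m)` satisfy `l, m ≤ n`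
because `a` and `b` are positive, so the box `1 ≤ l, m ≤ n` contains all of them. -/
def convSum (r s a b n : ℕ) : ℕ :=
  ∑ p ∈ (Finset.Icc 1 n ×ˢ Finset.Icc 1 n).filter (fun p => a * p.1 + b * p.2 = n),
    ArithmeticFunction.sigma r p.1 * ArithmeticFunction.sigma s p.2

/-- The complex vector space `M_k(N)` of modular forms of weight `k` on `Γ₀(N)`. -/
abbrev ModFormSpace (k N : ℕ) : Type :=
  ModularForm ((CongruenceSubgroup.Gamma0 N).map (Matrix.SpecialLinearGroup.mapGL ℝ)) (k : ℤ)

/-- The dimension `λ_k(N)` of `M_k(N)` over `ℂ`. -/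
noncomputable def modFormDim (k N : ℕ) : ℕ :=
  Module.finrank ℂ (ModFormSpace k N)

/-- The `n`-th Fourier coefficient `a_f(n)` of a form `f(z) = ∑_{n ≥ 0} a_f(n) e^{2πinz}`
in `M_k(N)`. -/
noncomputable def fourierCoeffAt {k N : ℕ} (f : ModFormSpace k N) (n : ℕ) : ℂ :=
  (UpperHalfPlane.qExpansion 1 f).coeff n

section

open UpperHalfPlane hiding I
open Complex Matrix.SpecialLinearGroup CongruenceSubgroup EisensteinSeries Derivative
open scoped Manifold MatrixGroups ModularForm Real Topology ArithmeticFunction.sigma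

local notation "𝕢" => Function.Periodic.qParam

/-! Let D = (2πi)⁻¹ d/dz and g(z) = b^(k-1) E_k(bz). The Serre derivative Dg - (k/12) E₂ g and the
product (a E₂(az) - E₂(z)) g are both modular of weight k + 2 on Γ₀(ab): the anomaly of E₂ cancels
in each. Combining them removes E₂(z) and gives the form F = Dg - (k/12) a E₂(az) g
(`quasiBracket`). The n-th coefficient of E₂(az) E_k(bz) contains the convolution sum
(`sum_antidiagonal_eisenstein`), so expanding F in the basis and solving for that sum gives the
formula. -/

/-! ### Boundedness at cusps -/

/-- The normalized derivative of a holomorphic function bounded at `i∞` is bounded at `i∞`. -/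
theorem isBoundedAtImInfty_normalizedDeriv {f : ℍ → ℂ} (hf : MDiff f)
    (hb : IsBoundedAtImInfty f) : IsBoundedAtImInfty (normalizedDerivOfComplex f) := by
  rw [isBoundedAtImInfty_iff] at hb ⊢
  obtain ⟨M, A, hM⟩ := hb
  rw [UpperHalfPlane.mdifferentiable_iff] at hf
  -- Cauchy's estimate on the unit disc about z; height |A| + 2 keeps that disc inside ℍ and above
  -- A.
  refine ⟨‖(2 * π * I : ℂ)⁻¹‖ * M, |A| + 2, fun z hz ↦ ?_⟩
  rw [normalizedDerivOfComplex, norm_mul]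
  have him : ∀ w ∈ Metric.closedBall (z : ℂ) 1, |A| + 1 ≤ w.im := fun w hw ↦ by
    have h1 := Complex.abs_im_le_norm (w - z)
    rw [Metric.mem_closedBall, dist_eq_norm] at hw
    have h2 := (abs_le.mp (h1.trans hw)).1
    simp only [sub_im, coe_im] at h2
    linarith
  have hpos : ∀ w ∈ Metric.closedBall (z : ℂ) 1, 0 < w.im := fun w hw ↦ by
    linarith [him w hw, abs_nonneg A]
  have hd : DiffContOnCl ℂ (f ∘ ofComplex) (Metric.ball (z : ℂ) 1) :=
    (hf.mono fun w hw ↦ hpos w hw).diffContOnCl_ball subset_rfl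
  gcongr
  have := Complex.norm_deriv_le_of_forall_mem_sphere_norm_le one_pos hd (C := M) fun w hw ↦ by
    have hw' := Metric.sphere_subset_closedBall hw
    rw [Function.comp_apply, ofComplex_apply_of_im_pos (hpos w hw')]
    exact hM _ (by
      have := him w hw'
      have := le_abs_self A
      change A ≤ w.im
      linarith)
  simpa using this

/-- If a holomorphic `f` is bounded in weight `k` at a rational cusp, then its Serre derivative is
bounded there in weight `k + 2`. -/
theorem IsBoundedAt.serreDerivative {f : ℍ → ℂ} (hf : MDiff f) {k : ℤ} {c : OnePoint ℝ}
    (hc : IsCusp c 𝒮ℒ) (hb : c.IsBoundedAt f k) :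
    c.IsBoundedAt (serreDerivative k f) (k + 2) := by
  rw [OnePoint.isBoundedAt_iff_forall_SL2Z hc] at hb ⊢
  intro γ hγ
  have h1 := hb γ hγ
  -- Equivariance reduces every cusp to i∞, applied to f slashed by γ.
  rw [serreDerivative_slash_equivariant hf]
  have h2 : MDiff (f ∣[k] γ) := hf.slash k _
  exact (isBoundedAtImInfty_normalizedDeriv h2 h1).sub
    (((Filter.const_boundedAtFilter _ _).mul isBoundedAtImInfty_E2).mul h1)

/-- The weight two Eisenstein series is bounded at all rational cusps. -/
theorem isBoundedAt_E2 {c : OnePoint ℝ} (hc : IsCusp c 𝒮ℒ) : c.IsBoundedAt E2 2 := by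
  rw [OnePoint.isBoundedAt_iff_forall_SL2Z hc]
  intro γ _
  rw [E2_slash_action, sub_eq_add_neg]
  refine isBoundedAtImInfty_E2.add (Filter.BoundedAtFilter.neg (Filter.BoundedAtFilter.smul _ ?_))
  -- The anomaly is 2πi c/(cz + d), and |c| ≤ |Im(cz + d)| once Im z ≥ 1.
  refine isBoundedAtImInfty_iff.mpr ⟨‖(2 * π * I : ℂ)‖, 1, fun z hz ↦ ?_⟩
  rw [D2, mul_div_assoc, norm_mul]
  refine mul_le_of_le_one_right (norm_nonneg _) ?_
  rw [norm_div]
  refine div_le_one_of_le₀ ?_ (norm_nonneg _)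
  refine le_trans ?_ (Complex.abs_im_le_norm _)
  rw [ModularGroup.denom_apply]
  simp only [add_im, mul_im, intCast_re, intCast_im, coe_im, zero_mul, add_zero, abs_mul,
    Complex.norm_intCast]
  exact le_mul_of_one_le_right (abs_nonneg _) (hz.trans (le_abs_self _))

/-! ### Dilations z ↦ dz and Γ₀(N) -/

/-- The matrix `diag(d, 1)`. -/
noncomputable def dilation (d : ℕ) (hd : 0 < d) : GL (Fin 2) ℝ :=
  Matrix.GeneralLinearGroup.mkOfDetNeZero !![(d : ℝ), 0; 0, 1] (by simp [hd.ne'])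

/-- The point `d z` of the upper half-plane. -/
noncomputable def dilate (d : ℕ) (hd : 0 < d) (z : ℍ) : ℍ :=
  ⟨d * z, by simpa using mul_pos (Nat.cast_pos.mpr hd) z.im_pos⟩

theorem coe_dilate (d : ℕ) (hd : 0 < d) (z : ℍ) : (dilate d hd z : ℂ) = d * z := rfl

theorem det_dilation (d : ℕ) (hd : 0 < d) : (dilation d hd).det.val = d := by
  simp [dilation, Matrix.GeneralLinearGroup.mkOfDetNeZero]

theorem slash_dilation (d : ℕ) (hd : 0 < d) (f : ℍ → ℂ) (k : ℤ) (z : ℍ) :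
    (f ∣[k] dilation d hd) z = (d : ℂ) ^ (k - 1) * f (dilate d hd z) := by
  have hpos : 0 < (dilation d hd).det.val := by
    rw [det_dilation]; exact_mod_cast hd
  have h1 : denom (dilation d hd) z = 1 := by
    simp [denom, dilation, Matrix.GeneralLinearGroup.mkOfDetNeZero]
  have h2 : dilation d hd • z = dilate d hd z := by
    ext1
    rw [UpperHalfPlane.coe_smul_of_det_pos hpos, h1, coe_dilate]
    simp [num, dilation, Matrix.GeneralLinearGroup.mkOfDetNeZero]
  have h3 : UpperHalfPlane.σ (dilation d hd) (f (dilation d hd • z)) = f (dilation d hd • z) := by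
    rw [UpperHalfPlane.σ, if_pos hpos]; rfl
  rw [ModularForm.slash_apply, h3, h1, h2, det_dilation]
  simp [mul_comm]

/-- Conjugation by `diag(d, 1)` carries `Γ₀(N)` into `SL(2, ℤ)` if `d ∣ N`. -/
theorem exists_dilation_mul {d N : ℕ} (hd : 0 < d) (hdN : d ∣ N) {γ : SL(2, ℤ)}
    (hγ : γ ∈ Gamma0 N) : ∃ γ' : SL(2, ℤ), dilation d hd * mapGL ℝ γ = mapGL ℝ γ' * dilation d hd ∧
      γ' 1 0 * d = γ 1 0 ∧ γ' 1 1 = γ 1 1 := by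
  rw [Gamma0_mem, ZMod.intCast_zmod_eq_zero_iff_dvd] at hγ
  obtain ⟨c, hc⟩ := (Int.natCast_dvd_natCast.mpr hdN).trans hγ
  have hdet := Matrix.det_fin_two γ.1
  rw [γ.2] at hdet
  -- This is diag(d, 1) γ diag(d, 1)⁻¹, integral because d divides the lower-left entry.
  obtain ⟨γ', e00, e01, e10, e11⟩ : ∃ γ' : SL(2, ℤ),
      γ' 0 0 = γ 0 0 ∧ γ' 0 1 = d * γ 0 1 ∧ γ' 1 0 = c ∧ γ' 1 1 = γ 1 1 := by
    refine ⟨⟨!![γ 0 0, d * γ 0 1; c, γ 1 1], ?_⟩, rfl, rfl, rfl, rfl⟩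
    rw [Matrix.det_fin_two_of]
    rw [hc] at hdet
    linarith
  refine ⟨γ', ?_, by rw [e10, hc, mul_comm], e11⟩
  have hc' : (γ 1 0 : ℝ) = d * c := by exact_mod_cast hc
  ext i j
  fin_cases i <;> fin_cases j <;>
    simp [dilation, Matrix.GeneralLinearGroup.mkOfDetNeZero, Matrix.mul_apply, hc', e00, e01,
      e10, e11, mul_comm]

open scoped Pointwise in
/-- `diag(d, 1)` maps cusps of `Γ₀(N)` to rational cusps. -/
theorem isCusp_dilation_smul {d : ℕ} (N : ℕ) (hd : 0 < d) (hdN : d ∣ N) {c : OnePoint ℝ}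
    (hc : IsCusp c ((Gamma0 N).map (mapGL ℝ))) : IsCusp (dilation d hd • c) 𝒮ℒ := by
  refine (hc.smul (dilation d hd)).mono ?_
  rintro _ ⟨_, ⟨γ, hγ, rfl⟩, rfl⟩
  obtain ⟨γ', h, -⟩ := exists_dilation_mul hd hdN hγ
  refine ⟨γ', ?_⟩
  simp [ConjAct.toConjAct_smul, h]

/-! ### Modular forms of level N -/

/-- The form `d ^ (k - 1) f(d z)` of level `N`, for `f` of level one and `d ∣ N`. -/
noncomputable def dilateForm {k : ℤ} (f : ModularForm 𝒮ℒ k) (d N : ℕ) (hd : 0 < d) (hdN : d ∣ N) :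
    ModularForm ((Gamma0 N).map (mapGL ℝ)) k where
  toFun := f ∣[k] dilation d hd
  slash_action_eq' := by
    rintro _ ⟨γ, hγ, rfl⟩
    obtain ⟨γ', h, -⟩ := exists_dilation_mul hd hdN hγ
    rw [← SlashAction.slash_mul, h, SlashAction.slash_mul,
      SlashInvariantForm.slash_action_eqn f _ (MonoidHom.mem_range.mpr ⟨γ', rfl⟩)]
  holo' := (ModularFormClass.holo f).slash k _
  bdd_at_cusps' hc :=
    OnePoint.IsBoundedAt.smul_iff.mp
      (ModularFormClass.bdd_at_cusps f (isCusp_dilation_smul N hd hdN hc))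

/-- The form `d E₂(d z) - E₂(z)` of weight two and level `N`, for `d ∣ N`. -/
noncomputable def E2Diff (d N : ℕ) (hd : 0 < d) (hdN : d ∣ N) :
    ModularForm ((Gamma0 N).map (mapGL ℝ)) 2 where
  toFun := E2 ∣[(2 : ℤ)] dilation d hd - E2
  slash_action_eq' := by
    rintro _ ⟨γ, hγ, rfl⟩
    obtain ⟨γ', h, h10, h11⟩ := exists_dilation_mul hd hdN hγ
    have e1 : E2 ∣[(2 : ℤ)] mapGL ℝ γ' = E2 - (1 / (2 * riemannZeta 2)) • D2 γ' :=
      E2_slash_action γ'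
    have e2 : E2 ∣[(2 : ℤ)] mapGL ℝ γ = E2 - (1 / (2 * riemannZeta 2)) • D2 γ :=
      E2_slash_action γ
    rw [sub_eq_add_neg, SlashAction.add_slash, SlashAction.neg_slash, ← SlashAction.slash_mul, h, SlashAction.slash_mul, e1, e2]
    have h10' : (γ' 1 0 * d : ℂ) = γ 1 0 := by exact_mod_cast h10
    -- The two anomalies agree since d c' = c, hence cancel in the difference.
    have e3 : D2 γ' ∣[(2 : ℤ)] dilation d hd = D2 γ := by
      ext z
      rw [slash_dilation, D2, D2, ModularGroup.denom_apply, ModularGroup.denom_apply, coe_dilate,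
        h11, ← h10']
      norm_num
      ring
    ext z
    have e4 := congrFun e3 z
    rw [slash_dilation] at e4
    simp only [Pi.add_apply, Pi.neg_apply, Pi.sub_apply, slash_dilation, Pi.smul_apply, smul_eq_mul, ← e4]
    ring
  holo' := (E2_mdifferentiable.slash 2 _).sub E2_mdifferentiable
  bdd_at_cusps' {c} hc := by
    have h1 := OnePoint.IsBoundedAt.smul_iff.mp (isBoundedAt_E2 (isCusp_dilation_smul N hd hdN hc))
    have h2 := isBoundedAt_E2 (hc.mono (by rintro _ ⟨γ, -, rfl⟩; exact ⟨γ, rfl⟩))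
    intro g hg
    rw [sub_eq_add_neg, SlashAction.add_slash, SlashAction.neg_slash]
    exact (h1 g hg).add (h2 g hg).neg

/-- The Serre derivative of a modular form of level `N`. -/
noncomputable def serreDerivativeForm {k : ℤ} {N : ℕ}
    (f : ModularForm ((Gamma0 N).map (mapGL ℝ)) k) :
    ModularForm ((Gamma0 N).map (mapGL ℝ)) (k + 2) where
  toFun := serreDerivative k f
  slash_action_eq' := by
    rintro _ ⟨γ, hγ, rfl⟩
    exact serreDerivative_slash_invariant (ModularFormClass.holo f)
      (SlashInvariantForm.slash_action_eqn f _ ⟨γ, hγ, rfl⟩)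
  holo' := serreDerivative_mdifferentiable k (ModularFormClass.holo f)
  bdd_at_cusps' hc :=
    IsBoundedAt.serreDerivative (ModularFormClass.holo f)
      (hc.mono (by rintro _ ⟨γ, -, rfl⟩; exact ⟨γ, rfl⟩)) (ModularFormClass.bdd_at_cusps f hc)

/-! ### Divisor sums and q-expansions -/

theorem divSigma_div_of_not_dvd (r : ℕ) {d n : ℕ} (hd : 0 < d) (h : ¬ d ∣ n) :
    divSigma r ((n : ℚ) / d) = 0 := by
  rw [divSigma, if_neg]
  rwa [Rat.den_div_natCast_eq_one_iff n d hd.ne']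

theorem divSigma_mul_div (r : ℕ) {d : ℕ} (hd : 0 < d) (n : ℕ) :
    divSigma r (((d * n : ℕ) : ℚ) / d) = ArithmeticFunction.sigma r n := by
  have : (((d * n : ℕ) : ℚ) / d) = n := by
    push_cast
    field_simp
  rw [this]
  simp [divSigma]

theorem divSigma_zero_div (r d : ℕ) : divSigma r (((0 : ℕ) : ℚ) / d) = 0 := by
  simp [divSigma]

/-- Substituting `d z` in a `q`-expansion with Eisenstein coefficients. -/
theorem hasSum_dilate {f : ℍ → ℂ} {r : ℕ} {β : ℂ}
    (hf : ∀ z : ℍ, HasSum (fun n : ℕ ↦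
      (if n = 0 then 1 else β * (ArithmeticFunction.sigma r n : ℂ)) * 𝕢 1 z ^ n) (f z))
    (d : ℕ) (hd : 0 < d) (z : ℍ) :
    HasSum (fun n : ℕ ↦ ((if n = 0 then 1 else 0) + β * (divSigma r ((n : ℚ) / d) : ℂ)) * 𝕢 1 z ^ n)
      (f (dilate d hd z)) := by
  have hinj : Function.Injective (fun n : ℕ ↦ d * n) := fun _ _ h ↦ Nat.eq_of_mul_eq_mul_left hd h
  rw [← hinj.hasSum_iff]
  · convert hf (dilate d hd z) using 2 with n
    have hq : 𝕢 1 (dilate d hd z) ^ n = 𝕢 1 z ^ (d * n) := by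
      simp only [Function.Periodic.qParam, coe_dilate, ← Complex.exp_nat_mul]
      congr 1
      push_cast
      ring
    rw [hq]
    simp only [Function.comp_apply, divSigma_mul_div r hd]
    -- `divSigma` vanishes at 0, so the indicator alone carries the constant term.
    rcases eq_or_ne n 0 with rfl | hn
    · simp
    · simp [hn, hd.ne']
  · intro n hn
    have hdn : ¬ d ∣ n := fun ⟨m, hm⟩ ↦ hn ⟨m, hm.symm⟩
    have hn0 : n ≠ 0 := by rintro rfl; exact hdn (dvd_zero d)
    simp [divSigma_div_of_not_dvd r hd hdn, hn0]

/-- Termwise differentiation of a `q`-expansion. -/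
theorem hasSum_normalizedDeriv {f : ℍ → ℂ} {c : ℕ → ℂ}
    (hf : ∀ z : ℍ, HasSum (fun n : ℕ ↦ c n * 𝕢 1 z ^ n) (f z)) (z : ℍ) :
    HasSum (fun n : ℕ ↦ (n * c n) * 𝕢 1 z ^ n) (normalizedDerivOfComplex f z) := by
  set U : Set ℂ := {w | z.im / 2 < w.im}
  have hU : IsOpen U := isOpen_lt continuous_const Complex.continuous_im
  have hpos : ∀ w ∈ U, 0 < w.im := fun w hw ↦ (half_pos z.im_pos).trans hw
  have hzU : (z : ℂ) ∈ U := half_lt_self z.im_pos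
  -- The series at half the height of z majorizes the terms on U, which allows termwise
  -- differentiation.
  set z' : ℍ := ⟨z.im / 2 * I, by simpa using z.im_pos⟩
  have hder (n : ℕ) (w : ℂ) : HasDerivAt (fun w ↦ c n * 𝕢 1 w ^ n)
      (2 * π * I * ((n * c n) * 𝕢 1 w ^ n)) w := by
    have h1 : HasDerivAt (fun w : ℂ ↦ c n * cexp (n * (2 * π * I * w)))
        (c n * (cexp (n * (2 * π * I * w)) * (n * (2 * π * I * 1)))) w :=
      (((hasDerivAt_id w).const_mul _).const_mul _).cexp.const_mul _
    convert h1 using 1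
    · ext w
      simp [Function.Periodic.qParam, ← Complex.exp_nat_mul]
    · simp only [Function.Periodic.qParam, ← Complex.exp_nat_mul, ofReal_one, div_one]
      ring
  have hsum : HasSum (fun n ↦ deriv (fun w ↦ c n * 𝕢 1 w ^ n) z)
      (deriv (fun w : ℂ ↦ ∑' n, c n * 𝕢 1 w ^ n) z) := by
    refine hasSum_deriv_of_summable_norm (hf z').summable.norm
      (fun n w _ ↦ (hder n w).differentiableAt.differentiableWithinAt) hU (fun n w hw ↦ ?_) hzU
    rw [norm_mul, norm_mul, norm_pow, norm_pow, Function.Periodic.norm_qParam,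
      Function.Periodic.norm_qParam]
    have hw' : z.im / 2 < w.im := hw
    have hz' : (z' : ℂ).im = z.im / 2 := by simp [z']
    rw [hz']
    gcongr ‖c n‖ * Real.exp ?_ ^ n
    have := Real.pi_pos
    simp only [div_one]
    nlinarith
  have heq : (f ∘ ofComplex) =ᶠ[𝓝 (z : ℂ)] fun w ↦ ∑' n, c n * 𝕢 1 w ^ n := by
    filter_upwards [hU.mem_nhds hzU] with w hw
    rw [Function.comp_apply, ofComplex_apply_of_im_pos (hpos w hw)]
    exact (hf ⟨w, hpos w hw⟩).tsum_eq.symm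
  rw [normalizedDerivOfComplex, heq.deriv_eq]
  refine (hsum.mul_left (2 * π * I : ℂ)⁻¹).congr_fun fun n ↦ ?_
  rw [(hder n z).deriv, inv_mul_cancel_left₀ Complex.two_pi_I_ne_zero]

/-- The Cauchy product of two absolutely convergent `q`-expansions. -/
theorem hasSum_qSeries_mul {x u v : ℂ} {c e : ℕ → ℂ} (hc : HasSum (fun n ↦ c n * x ^ n) u)
    (he : HasSum (fun n ↦ e n * x ^ n) v) :
    HasSum (fun n ↦ (∑ p ∈ Finset.HasAntidiagonal.antidiagonal n, c p.1 * e p.2) * x ^ n) (u * v) := by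
  have h := summable_norm_sum_mul_antidiagonal_of_summable_norm hc.summable.norm he.summable.norm
  have ht := tsum_mul_tsum_eq_tsum_sum_antidiagonal_of_summable_norm hc.summable.norm
    he.summable.norm
  rw [hc.tsum_eq, he.tsum_eq] at ht
  rw [ht]
  refine h.of_norm.hasSum.congr_fun fun n ↦ ?_
  rw [Finset.sum_mul]
  refine Finset.sum_congr rfl fun p hp ↦ ?_
  rw [← Finset.HasAntidiagonal.mem_antidiagonal.mp hp, pow_add]
  ring

/-- Only pairs (al, bm) contribute, and l = 0 or m = 0 adds nothing because σ(0) = 0 by convention.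
-/
theorem convSum_eq_sum_antidiagonal (r s : ℕ) {a b : ℕ} (ha : 0 < a) (hb : 0 < b) (n : ℕ) :
    convSum r s a b n = ∑ p ∈ Finset.HasAntidiagonal.antidiagonal n,
      divSigma r ((p.1 : ℚ) / a) * divSigma s ((p.2 : ℚ) / b) := by
  rw [convSum]
  refine Finset.sum_of_injOn (fun p ↦ (a * p.1, b * p.2)) ?_ ?_ ?_ ?_
  · rintro ⟨i, j⟩ - ⟨i', j'⟩ - h
    simp only [Prod.mk.injEq] at h
    rw [Nat.eq_of_mul_eq_mul_left ha h.1, Nat.eq_of_mul_eq_mul_left hb h.2]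
  · rintro ⟨i, j⟩ h
    simpa using (Finset.mem_filter.mp h).2
  · rintro ⟨x, y⟩ hxy hni
    rw [Finset.HasAntidiagonal.mem_antidiagonal] at hxy
    by_cases hx : a ∣ x
    · by_cases hy : b ∣ y
      · obtain ⟨i, rfl⟩ := hx
        obtain ⟨j, rfl⟩ := hy
        simp only [divSigma_mul_div r ha, divSigma_mul_div s hb]
        rcases Nat.eq_zero_or_pos i with rfl | hi
        · simp
        rcases Nat.eq_zero_or_pos j with rfl | hj
        · simp
        refine absurd ⟨(i, j), ?_, rfl⟩ hni
        have := Nat.le_mul_of_pos_left i ha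
        have := Nat.le_mul_of_pos_left j hb
        dsimp only at hxy
        simp only [Finset.coe_filter, Finset.mem_product, Finset.mem_Icc, Set.mem_ofPred_eq]
        lia
      · simp [divSigma_div_of_not_dvd s hb hy]
    · simp [divSigma_div_of_not_dvd r ha hx]
  · rintro ⟨i, j⟩ -
    simp only [divSigma_mul_div r ha, divSigma_mul_div s hb]

/-- Coefficients of the product of two Eisenstein-type `q`-expansions. -/
theorem sum_antidiagonal_eisenstein (r s : ℕ) {a b : ℕ} (ha : 0 < a) (hb : 0 < b) (β γ : ℂ)
    {n : ℕ} (hn : 0 < n) :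
    ∑ p ∈ Finset.HasAntidiagonal.antidiagonal n,
      ((if p.1 = 0 then 1 else 0) + β * (divSigma r ((p.1 : ℚ) / a) : ℂ)) *
        ((if p.2 = 0 then 1 else 0) + γ * (divSigma s ((p.2 : ℚ) / b) : ℂ)) =
      β * divSigma r ((n : ℚ) / a) + γ * divSigma s ((n : ℚ) / b) +
        β * γ * convSum r s a b n := by
  rw [convSum_eq_sum_antidiagonal r s ha hb]
  push_cast
  simp only [add_mul, mul_add, Finset.sum_add_distrib]
  have h1 : ∑ p ∈ Finset.HasAntidiagonal.antidiagonal n, (if p.1 = 0 then (1 : ℂ) else 0) *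
      (if p.2 = 0 then 1 else 0) = 0 :=
    Finset.sum_eq_zero fun p hp ↦ by
      have := Finset.HasAntidiagonal.mem_antidiagonal.mp hp
      split_ifs <;> lia
  have h2 : ∑ p ∈ Finset.HasAntidiagonal.antidiagonal n, (if p.1 = 0 then (1 : ℂ) else 0) *
      (γ * (divSigma s ((p.2 : ℚ) / b) : ℂ)) = γ * divSigma s ((n : ℚ) / b) := by
    rw [Finset.sum_eq_single (0, n)]
    · simp
    · rintro ⟨x, y⟩ hp hne
      have := Finset.HasAntidiagonal.mem_antidiagonal.mp hp
      have : x ≠ 0 := by rintro rfl; simp_all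
      simp [this]
    · simp
  have h3 : ∑ p ∈ Finset.HasAntidiagonal.antidiagonal n, β * (divSigma r ((p.1 : ℚ) / a) : ℂ) *
      (if p.2 = 0 then (1 : ℂ) else 0) = β * divSigma r ((n : ℚ) / a) := by
    rw [Finset.sum_eq_single (n, 0)]
    · simp
    · rintro ⟨x, y⟩ hp hne
      have := Finset.HasAntidiagonal.mem_antidiagonal.mp hp
      have : y ≠ 0 := by rintro rfl; simp_all
      simp [this]
    · simp
  rw [h1, h2, h3, Finset.mul_sum]
  have h4 (p : ℕ × ℕ) : β * (divSigma r ((p.1 : ℚ) / a) : ℂ) * (γ * (divSigma s ((p.2 : ℚ) / b) : ℂ))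
      = β * γ * ((divSigma r ((p.1 : ℚ) / a) : ℂ) * (divSigma s ((p.2 : ℚ) / b) : ℂ)) := by ring
  simp only [h4]
  ring

/-- By Euler's formula a zero would force ζ(k) = 0, impossible for k > 1. -/
theorem bernoulli_ne_zero_of_even {k : ℕ} (hk : 2 ≤ k) (hk2 : Even k) : bernoulli k ≠ 0 := by
  obtain ⟨m, rfl⟩ := hk2
  intro h
  have hz := riemannZeta_two_mul_nat (k := m) (by lia)
  rw [two_mul m, h] at hz
  refine riemannZeta_ne_zero_of_one_lt_re (s := 2 * m) ?_ (by simpa using hz)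
  have : (1 : ℝ) ≤ m := by exact_mod_cast (by lia : 1 ≤ m)
  simp
  linarith

/-! ### The form F and its coefficients -/

/-- The form `D g - (k / 12) a E₂(a z) g` of level `N`, where `g(z) = b ^ (k - 1) f(b z)`. -/
noncomputable def quasiBracket {k : ℕ} (f : ModularForm 𝒮ℒ k) (a b N : ℕ) (ha : 0 < a) (hb : 0 < b)
    (haN : a ∣ N) (hbN : b ∣ N) : ModFormSpace (k + 2) N :=
  ModularForm.mcast (by push_cast; ring) (serreDerivativeForm (dilateForm f b N hb hbN)) -
    ((k : ℂ) / 12) • ModularForm.mcast (by push_cast; ring)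
      ((E2Diff a N ha haN).mul (dilateForm f b N hb hbN))

/-- The E₂(z) g terms of the Serre derivative and of `E2Diff` cancel. -/
theorem quasiBracket_apply {k : ℕ} (f : ModularForm 𝒮ℒ k) {a b N : ℕ} (ha : 0 < a) (hb : 0 < b)
    (haN : a ∣ N) (hbN : b ∣ N) (z : ℍ) :
    quasiBracket f a b N ha hb haN hbN z =
      normalizedDerivOfComplex ((f : ℍ → ℂ) ∣[(k : ℤ)] dilation b hb) z -
        (k / 12) * (a * E2 (dilate a ha z) * ((f : ℍ → ℂ) ∣[(k : ℤ)] dilation b hb) z) := by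
  have h1 : quasiBracket f a b N ha hb haN hbN z =
      serreDerivative ((k : ℤ) : ℂ) ((f : ℍ → ℂ) ∣[(k : ℤ)] dilation b hb) z -
        (k / 12) * ((E2 ∣[(2 : ℤ)] dilation a ha - E2) z * ((f : ℍ → ℂ) ∣[(k : ℤ)] dilation b hb) z) := rfl
  rw [h1, serreDerivative_apply, Pi.sub_apply, slash_dilation a ha E2]
  norm_num
  ring

theorem fourierCoeffAt_eq {k N : ℕ} (f : ModFormSpace k N) {c : ℕ → ℂ}
    (hf : ∀ z : ℍ, HasSum (fun n ↦ c n * 𝕢 1 z ^ n) (f z)) (n : ℕ) : fourierCoeffAt f n = c n :=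
  (ModularFormClass.qExpansion_coeff_unique one_pos (by simp) hf n).symm

theorem hasSum_fourierCoeffAt {k N : ℕ} [NeZero N] (f : ModFormSpace k N) (z : ℍ) :
    HasSum (fun n ↦ fourierCoeffAt f n * 𝕢 1 z ^ n) (f z) :=
  ModularForm.hasSum_qExpansion f one_pos (by simp) z

/-- Fourier coefficients are linear. -/
theorem fourierCoeffAt_sum_smul {k N : ℕ} [NeZero N] {ι : Type*} [Fintype ι] (c : ι → ℂ)
    (f : ι → ModFormSpace k N) (n : ℕ) :
    fourierCoeffAt (∑ i, c i • f i) n = ∑ i, c i * fourierCoeffAt (f i) n := by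
  refine fourierCoeffAt_eq (c := fun n ↦ ∑ i, c i * fourierCoeffAt (f i) n) _ (fun z ↦ ?_) n
  have h := hasSum_sum (s := Finset.univ) fun i _ ↦ (hasSum_fourierCoeffAt (f i) z).mul_left (c i)
  have he : (∑ i, c i • f i) z = ∑ i, c i * f i z := by
    have := map_sum (FunLike.coeAddMonoidHom (ModFormSpace k N) ℍ ℂ) (fun i ↦ c i • f i) Finset.univ
    exact (congrFun this z).trans (Finset.sum_apply _ _ _)
  rw [he]
  refine h.congr_fun fun m ↦ ?_
  simp only [Finset.sum_mul, mul_assoc]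

theorem fourierCoeffAt_quasiBracket_E {k a b N : ℕ} (hk : 3 ≤ k) (hk2 : Even k) (ha : 0 < a)
    (hb : 0 < b) (haN : a ∣ N) (hbN : b ∣ N) {n : ℕ} (hn : 0 < n) :
    fourierCoeffAt (quasiBracket (ModularForm.E hk) a b N ha hb haN hbN) n =
      (b : ℂ) ^ (k - 1) *
        (n * (-(2 * k / bernoulli k) * divSigma (k - 1) ((n : ℚ) / b)) -
          (k / 12) * a * (-24 * divSigma 1 ((n : ℚ) / a)
            + -(2 * k / bernoulli k) * divSigma (k - 1) ((n : ℚ) / b)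
            + -24 * -(2 * k / bernoulli k) * convSum 1 (k - 1) a b n)) := by
  set β : ℂ := -(2 * k / bernoulli k)
  have hE (z : ℍ) : HasSum (fun n : ℕ ↦ (if n = 0 then 1
      else β * (ArithmeticFunction.sigma (k - 1) n : ℂ)) * 𝕢 1 z ^ n) (ModularForm.E hk z) := by
    have := ModularForm.hasSum_qExpansion (ModularForm.E hk) one_pos (by simp) z
    simpa only [EisensteinSeries.E_qExpansion_coeff hk hk2] using this
  have hE2 (z : ℍ) : HasSum (fun n : ℕ ↦ (if n = 0 then 1
      else -24 * (ArithmeticFunction.sigma 1 n : ℂ)) * 𝕢 1 z ^ n) (E2 z) := by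
    simpa [Function.Periodic.qParam] using hasSum_qExpansion_E2 (z := z)
  have hexp : (b : ℂ) ^ ((k : ℤ) - 1) = (b : ℂ) ^ (k - 1) := by
    rw [← zpow_natCast, Nat.cast_sub (by lia), Nat.cast_one]
  have hg (z : ℍ) : HasSum (fun n : ℕ ↦ ((b : ℂ) ^ (k - 1) * ((if n = 0 then 1 else 0) +
      β * (divSigma (k - 1) ((n : ℚ) / b) : ℂ))) * 𝕢 1 z ^ n)
      (((ModularForm.E hk : ℍ → ℂ) ∣[(k : ℤ)] dilation b hb) z) := by
    rw [slash_dilation, hexp]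
    simpa only [mul_assoc] using (hasSum_dilate hE b hb z).mul_left ((b : ℂ) ^ (k - 1))
  have hF (z : ℍ) := (hasSum_normalizedDeriv hg z).sub
    ((hasSum_qSeries_mul (hasSum_dilate hE2 a ha z) (hasSum_dilate hE b hb z)).mul_left
      ((k / 12 : ℂ) * a * (b : ℂ) ^ (k - 1)))
  have hcoeff := fourierCoeffAt_eq (quasiBracket (ModularForm.E hk) a b N ha hb haN hbN)
    (c := fun n ↦ n * ((b : ℂ) ^ (k - 1) * ((if n = 0 then 1 else 0) +
      β * (divSigma (k - 1) ((n : ℚ) / b) : ℂ))) - (k / 12 : ℂ) * a * (b : ℂ) ^ (k - 1) *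
      ∑ p ∈ Finset.HasAntidiagonal.antidiagonal n,
        ((if p.1 = 0 then 1 else 0) + -24 * (divSigma 1 ((p.1 : ℚ) / a) : ℂ)) *
        ((if p.2 = 0 then 1 else 0) + β * (divSigma (k - 1) ((p.2 : ℚ) / b) : ℂ))) (fun z ↦ by
      rw [quasiBracket_apply]
      have hval : (k / 12 : ℂ) * (a * E2 (dilate a ha z) *
          ((ModularForm.E hk : ℍ → ℂ) ∣[(k : ℤ)] dilation b hb) z) =
          (k / 12 : ℂ) * a * (b : ℂ) ^ (k - 1) *
            (E2 (dilate a ha z) * ModularForm.E hk (dilate b hb z)) := by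
        rw [slash_dilation, hexp]
        ring
      rw [hval]
      refine (hF z).congr_fun fun m ↦ ?_
      ring) n
  rw [hcoeff, sum_antidiagonal_eisenstein 1 (k - 1) ha hb _ _ hn, if_neg hn.ne']
  ring

end

theorem corollary2p3 (k a b : ℕ) (hk : 4 ≤ k) (hkeven : Even k) (ha : 0 < a) (hb : 0 < b)
    (hab : Nat.Coprime a b)
    (f : Module.Basis (Fin (modFormDim (k + 2) (a * b))) ℂ (ModFormSpace (k + 2) (a * b))) :
    ∃ α : Fin (modFormDim (k + 2) (a * b)) → ℂ, ∀ n : ℕ, 0 < n →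
      (convSum 1 (k - 1) a b n : ℂ) =
        (bernoulli k : ℂ) / (2 * (k : ℂ)) * (divSigma 1 ((n : ℚ) / (a : ℚ)) : ℂ)
        + (1 / 24 - (n : ℂ) / (2 * (k : ℂ) * (a : ℂ)))
            * (divSigma (k - 1) ((n : ℚ) / (b : ℚ)) : ℂ)
        - (bernoulli k : ℂ) / (4 * (a : ℂ) * (k : ℂ) ^ 2)
            * ∑ i, α i * fourierCoeffAt (f i) n := by
  have : NeZero (a * b) := ⟨(Nat.mul_pos ha hb).ne'⟩
  set F := quasiBracket (ModularForm.E (by lia : 3 ≤ k)) a b (a * b) ha hb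
    (dvd_mul_right a b) (dvd_mul_left b a) with hF
  -- The coordinates of F, divided by the factor b^(k-1) that the slash action put into g.
  refine ⟨fun i ↦ ((b : ℂ) ^ (k - 1))⁻¹ * f.repr F i, fun n hn ↦ ?_⟩
  have h := fourierCoeffAt_sum_smul (f.repr F) f n
  rw [f.sum_repr, hF, fourierCoeffAt_quasiBracket_E (by lia) hkeven ha hb _ _ hn, ← hF] at h
  simp only [mul_assoc (((b : ℂ) ^ (k - 1))⁻¹), ← Finset.mul_sum]
  have ha' : (a : ℂ) ≠ 0 := by exact_mod_cast ha.ne'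
  have hb' : (b : ℂ) ^ (k - 1) ≠ 0 := pow_ne_zero _ (by exact_mod_cast hb.ne')
  have hk' : (k : ℂ) ≠ 0 := by exact_mod_cast (by lia : k ≠ 0)
  have hB : (bernoulli k : ℂ) ≠ 0 := by
    exact_mod_cast bernoulli_ne_zero_of_even (by lia) hkeven
  -- After this cancellation the convolution sum has coefficient -4ak²/B_k in the sum over the
  -- basis, whence the prefactor -B_k/(4ak²).
  rw [← h, inv_mul_cancel_left₀ hb']
  field_simp
  ring
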